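/- Let $n\ge 0$ be an integer and $\hbar>0$. Write points of $\mathbb{R}^{2n}=\mathbb{R}^n\times\mathbb{R}^n$ as $z=(x,p)$ and let $\sigma(z,z')=p\cdot x'-p'\cdot x$ be the standard symplectic form. For a symbol $a\in\mathcal{S}(\mathbb{R}^{2n})$, a bounded operator $\widehat{A}$ on $L^2(\mathbb{R}^n)$ is called the Weyl operator with symbol $a$, written $\widehat{A}\overset{\mathrm{Weyl}}{\longleftrightarrow}a$, if for all $\psi\in\mathcal{S}(\mathbb{R}^n)$ $$\widehat{A}\psi(x)=\left(\tfrac{1}{2\pi\hbar}\right)^{n}\iint_{\mathbb{R}^{2n}}e^{\frac{i}{\hbar}p\cdot(x-y)}\,a\!\left(\tfrac12(x+y),p\right)\psi(y)\,dy\,dp\quad\text{for almost every }x\in\mathbb{R}^n .$$ Let $M\in GL(2n,\mathbb{R})$, and assume that there exists a unitary operator $\widehat{M}:L^2(\mathbb{R}^n)\to L^2(\mathbb{R}^n)$ such that $$\widehat{M}\widehat{A}\widehat{M}^{-1}\overset{\mathrm{Weyl}}{\longleftrightarrow}a\circ M^{-1}\qquad\text{whenever } a\in\mathcal{S}(\mathbb{R}^{2n})\text{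 and }\widehat{A}\overset{\mathrm{Weyl}}{\longleftrightarrow}a .$$ Then $M$ is symplectic, that is $\sigma(Mz,Mz')=\sigma(z,z')$ for all $z,z'\in\mathbb{R}^{2n}$, or antisymplectic, that is $\sigma(Mz,Mz')=-\sigma(z,z')$ for all $z,z'\in\mathbb{R}^{2n}$. -/

import Mathlib

open MeasureTheory SchwartzMap
open scoped SchwartzMap

namespace WeylCovariance

/-- Configuration space `ℝⁿ`, with its Euclidean structure. -/
abbrev Config (n : ℕ) : Type := EuclideanSpace ℝ (Fin n)

/-- Phase space `ℝ²ⁿ = ℝⁿ × ℝⁿ`, with points `z = (x, p)`. -/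
abbrev Phase (n : ℕ) : Type := Config n × Config n

/-- The Hilbert space `L²(ℝⁿ)` of complex-valued functions. -/
abbrev L2 (n : ℕ) : Type := Lp ℂ 2 (volume : Measure (Config n))

/-- The standard symplectic form `σ(z, z') = p ⬝ x' - p' ⬝ x` for `z = (x, p)`, `z' = (x', p')`. -/
noncomputable def sigma {n : ℕ} (z z' : Phase n) : ℝ :=
  inner ℝ z.2 z'.1 - inner ℝ z'.2 z.1

/-- `M` is symplectic: it preserves the symplectic form. -/
def IsSymplectic {n : ℕ} (M : Phase n ≃L[ℝ] Phase n) : Prop :=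
  ∀ z z' : Phase n, sigma (M z) (M z') = sigma z z'

/-- `M` is antisymplectic: it changes the sign of the symplectic form. -/
def IsAntisymplectic {n : ℕ} (M : Phase n ≃L[ℝ] Phase n) : Prop :=
  ∀ z z' : Phase n, sigma (M z) (M z') = - sigma z z'

/-- The Weyl operator with Schwartz symbol `a`, applied to a Schwartz function `ψ`:
`(2πħ)⁻ⁿ ∬ exp((i/ħ) p ⬝ (x - y)) a((x + y)/2, p) ψ(y) dy dp`.
The integration variable is `w = (y, p)`; the integrand is absolutely integrable. -/
noncomputable def weylIntegral {n : ℕ} (hbar : ℝ) (a : 𝓢(Phase n, ℂ)) (ψ : 𝓢(Config n, ℂ))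
    (x : Config n) : ℂ :=
  (((1 / (2 * Real.pi * hbar)) ^ n : ℝ) : ℂ) *
    ∫ w : Phase n,
      Complex.exp (Complex.I / (hbar : ℂ) * ((inner ℝ w.2 (x - w.1) : ℝ) : ℂ)) *
        a ((1 / 2 : ℝ) • (x + w.1), w.2) * ψ w.1

/-- The Weyl correspondence `A ↔ a` between bounded operators on `L²(ℝⁿ)` and Schwartz symbols:
`A` is given on the dense subspace of Schwartz functions by the Weyl integral with symbol `a`. -/
def IsWeyl {n : ℕ} (hbar : ℝ) (A : L2 n →L[ℂ] L2 n) (a : 𝓢(Phase n, ℂ)) : Prop :=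
  ∀ ψ : 𝓢(Config n, ℂ), (A (ψ.toLp 2 volume) : Config n → ℂ) =ᵐ[volume] weylIntegral hbar a ψ

/-- The symbol `a ∘ M⁻¹`. -/
noncomputable def compInv {n : ℕ} (a : 𝓢(Phase n, ℂ)) (M : Phase n ≃L[ℝ] Phase n) :
    𝓢(Phase n, ℂ) :=
  SchwartzMap.compCLMOfContinuousLinearEquiv ℂ M.symm a

/-- The conjugated operator `U A U⁻¹`, for a unitary operator `U` on `L²(ℝⁿ)`. -/
noncomputable def conjBy {n : ℕ} (U : L2 n ≃ₗᵢ[ℂ] L2 n) (A : L2 n →L[ℂ] L2 n) :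
    L2 n →L[ℂ] L2 n :=
  (U.toContinuousLinearEquiv : L2 n →L[ℂ] L2 n) ∘L A ∘L
    (U.symm.toContinuousLinearEquiv : L2 n →L[ℂ] L2 n)

end WeylCovariance

/-! Let `W z` be the Heisenberg-Weyl translations. Conjugating a Weyl operator by `W z` translates
its symbol by `z`, so covariance makes `V z = U⁻¹ W(Mz)⁻¹ U W(z)` commute with every Weyl operator
(`shiftDefect_commute`). A Gaussian symbol gives a nonzero multiple of the rank-one operator of the
ground state `g` (`isWeyl_gaussianSymbol`), and its translates give those of the coherent states
`W(w) g`. Hence every coherent state is an eigenvector of `V z`.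

No coherent state is orthogonal to `g` (`inner_groundState_weylShift_ne_zero`), so the isometry `V
z` has one eigenvalue `c z` on all of them: `U W(z) = c(z) W(Mz) U` on coherent states. The scalars
cancel in the commutation relations, leaving `exp(iσ(Mz,Mw)/ħ) = exp(iσ(z,w)/ħ)`; scaling `z`
removes the ambiguity modulo `2π`. -/

namespace WeylCovariance

/-! ### Gaussians as Schwartz functions; temperate growth of phases. -/

section Schwartz

theorem iteratedDeriv_gaussian (b : ℝ) (n : ℕ) :
    ∃ P : Polynomial ℝ, ∀ x : ℝ,
      iteratedDeriv n (fun x : ℝ => Real.exp (-b * x ^ 2)) x = P.eval x * Real.exp (-b * x ^ 2) := by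
  induction n with
  | zero => exact ⟨1, fun x => by simp⟩
  | succ n ih =>
    obtain ⟨P, hP⟩ := ih
    refine ⟨P.derivative - Polynomial.C (2 * b) * Polynomial.X * P, fun x => ?_⟩
    rw [iteratedDeriv_succ, funext hP]
    have h : HasDerivAt (fun x : ℝ => Real.exp (-b * x ^ 2))
        (Real.exp (-b * x ^ 2) * (-b * (2 * x))) x := by
      simpa using (((hasDerivAt_id x).pow 2).const_mul (-b)).exp
    refine ((P.hasDerivAt x).mul h).deriv.trans ?_
    simp
    ring

theorem pow_mul_gaussian_le {b : ℝ} (hb : 0 < b) (k : ℕ) (x : ℝ) :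
    |x| ^ k * Real.exp (-b * x ^ 2) ≤ 1 + k.factorial / b ^ k := by
  have h1 : |x| ^ k ≤ 1 + (x ^ 2) ^ k := by
    rw [← sq_abs x]
    nlinarith [sq_nonneg (|x| ^ k - 1), pow_mul_comm' |x| k, pow_nonneg (abs_nonneg x) k,
      (by rw [← pow_mul, ← pow_mul, mul_comm] : (|x| ^ 2) ^ k = (|x| ^ k) ^ 2)]
  have h2 : (x ^ 2) ^ k * Real.exp (-b * x ^ 2) ≤ k.factorial / b ^ k := by
    have h := Real.pow_div_factorial_le_exp (b * x ^ 2) (by positivity) k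
    rw [div_le_iff₀ (by positivity), mul_pow] at h
    rw [le_div_iff₀ (by positivity), neg_mul, Real.exp_neg, ← div_eq_mul_inv, div_mul_eq_mul_div,
      div_le_iff₀ (Real.exp_pos _)]
    linarith
  have h3 : Real.exp (-b * x ^ 2) ≤ 1 := Real.exp_le_one_iff.2 (by nlinarith [sq_nonneg x])
  nlinarith [Real.exp_pos (-b * x ^ 2)]

theorem exists_polynomial_mul_gaussian_le {b : ℝ} (hb : 0 < b) (P : Polynomial ℝ) :
    ∀ k : ℕ, ∃ C : ℝ, ∀ x : ℝ, |x| ^ k * |P.eval x * Real.exp (-b * x ^ 2)| ≤ C := by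
  induction P using Polynomial.induction_on' with
  | add P Q hP hQ =>
    intro k
    obtain ⟨C, hC⟩ := hP k
    obtain ⟨D, hD⟩ := hQ k
    refine ⟨C + D, fun x => ?_⟩
    rw [Polynomial.eval_add, add_mul]
    nlinarith [hC x, hD x, pow_nonneg (abs_nonneg x) k, abs_add_le (P.eval x * Real.exp (-b * x ^ 2))
      (Q.eval x * Real.exp (-b * x ^ 2))]
  | monomial m c =>
    intro k
    refine ⟨|c| * (1 + (k + m).factorial / b ^ (k + m)), fun x => ?_⟩
    have := mul_le_mul_of_nonneg_left (pow_mul_gaussian_le hb (k + m) x) (abs_nonneg c)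
    rw [Polynomial.eval_monomial, abs_mul, abs_mul, abs_pow, Real.abs_exp]
    refine le_trans (le_of_eq ?_) this
    ring

/-- The Gaussian `exp (-b x²)` on the line as a Schwartz function. -/
noncomputable def realGaussian (b : ℝ) (hb : 0 < b) : 𝓢(ℝ, ℂ) where
  toFun x := (Real.exp (-b * x ^ 2) : ℂ)
  smooth' := Complex.ofRealCLM.contDiff.comp (f := fun x : ℝ => Real.exp (-b * x ^ 2)) (by fun_prop)
  decay' k n := by
    obtain ⟨P, hP⟩ := iteratedDeriv_gaussian b n
    obtain ⟨C, hC⟩ := exists_polynomial_mul_gaussian_le hb P k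
    refine ⟨C, fun x => ?_⟩
    have h := Complex.ofRealLI.norm_iteratedFDeriv_comp_left (𝕜 := ℝ)
      (f := fun x : ℝ => Real.exp (-b * x ^ 2)) (x := x) (n := ⊤) (i := n)
      (ContDiff.contDiffAt (by fun_prop)) (by exact_mod_cast le_top)
    have h' : ‖iteratedFDeriv ℝ n (fun x : ℝ => (Real.exp (-b * x ^ 2) : ℂ)) x‖ =
      ‖iteratedFDeriv ℝ n (fun x : ℝ => Real.exp (-b * x ^ 2)) x‖ := h
    rw [h', norm_iteratedFDeriv_eq_norm_iteratedDeriv, hP]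
    exact hC x

theorem norm_le_sqrt_one_add_norm_sq {H : Type*} [NormedAddCommGroup H] (x : H) :
    ‖x‖ ≤ (1 + ‖x‖ ^ 2) ^ (1 / 2 : ℝ) := by
  rw [← Real.sqrt_eq_rpow]
  exact Real.le_sqrt_of_sq_le (by linarith)

/-- The Gaussian `exp (-b ‖x‖²)` on an inner product space as a Schwartz function. -/
noncomputable def normGaussian {H : Type*} [NormedAddCommGroup H] [InnerProductSpace ℝ H]
    (b : ℝ) (hb : 0 < b) : 𝓢(H, ℂ) :=
  -- The norm is not smooth at 0, so `√(1 + ‖x‖²)` replaces it; the factor `exp b` cancels the added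
  -- 1.
  (Real.exp b : ℂ) • SchwartzMap.compCLM ℂ (g := fun x : H => (1 + ‖x‖ ^ 2) ^ (1 / 2 : ℝ))
    (Function.hasTemperateGrowth_one_add_norm_sq_rpow H _)
    ⟨1, 1, fun x => by
      have h := norm_le_sqrt_one_add_norm_sq x
      have h' := Real.le_norm_self ((1 + ‖x‖ ^ 2) ^ (1 / 2 : ℝ))
      linarith⟩ (realGaussian b hb)

theorem normGaussian_apply {H : Type*} [NormedAddCommGroup H] [InnerProductSpace ℝ H]
    (b : ℝ) (hb : 0 < b) (x : H) :
    normGaussian b hb x = Complex.exp (-(b : ℂ) * (‖x‖ : ℂ) ^ 2) := by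
  change (Real.exp b : ℂ) * (Real.exp (-b * ((1 + ‖x‖ ^ 2) ^ (1 / 2 : ℝ)) ^ 2) : ℂ) = _
  rw [← Real.sqrt_eq_rpow, Real.sq_sqrt (by positivity), ← Complex.ofReal_mul, ← Real.exp_add,
    Complex.ofReal_exp]
  push_cast
  congr 1
  ring

theorem hasTemperateGrowth_cexp_I_mul :
    (fun t : ℝ => Complex.exp (Complex.I * t)).HasTemperateGrowth := by
  have hd : ∀ n : ℕ, iteratedDeriv n (fun t : ℝ => Complex.exp (Complex.I * t)) =
      fun t : ℝ => Complex.I ^ n * Complex.exp (Complex.I * t) := by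
    intro n
    induction n with
    | zero => simp
    | succ n ih =>
      ext t
      rw [iteratedDeriv_succ, ih]
      have h : HasDerivAt (fun t : ℝ => Complex.exp (Complex.I * t))
          (Complex.exp (Complex.I * t) * (Complex.I * 1)) t :=
        ((Complex.ofRealCLM.hasDerivAt (x := t)).const_mul Complex.I).cexp
      rw [(h.const_mul (Complex.I ^ n)).deriv]
      ring
  refine ⟨?_, fun n => ⟨0, 1, fun t => ?_⟩⟩
  · exact (contDiff_const.mul Complex.ofRealCLM.contDiff).cexp
  · rw [norm_iteratedFDeriv_eq_norm_iteratedDeriv, hd]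
    simp [Complex.norm_exp]

end Schwartz

variable {n : ℕ}

/-! ### Heisenberg-Weyl translations and their commutation relations. -/

section HeisenbergWeyl

/-- The unimodular factor `exp ((i/ħ) (k ⬝ x - k ⬝ q / 2))`, for `z = (q, k)`. -/
noncomputable def weylPhase (hbar : ℝ) (z : Phase n) (x : Config n) : ℂ :=
  Complex.exp (Complex.I * (((inner ℝ z.2 x - inner ℝ z.2 z.1 / 2) / hbar : ℝ) : ℂ))

theorem norm_weylPhase (hbar : ℝ) (z : Phase n) (x : Config n) : ‖weylPhase hbar z x‖ = 1 := by
  rw [weylPhase, mul_comm, Complex.norm_exp_ofReal_mul_I]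

theorem hasTemperateGrowth_weylPhase (hbar : ℝ) (z : Phase n) :
    (weylPhase hbar z).HasTemperateGrowth := by
  have h : (fun x : Config n =>
      (inner ℝ z.2 x - inner ℝ z.2 z.1 / 2) / hbar).HasTemperateGrowth := by
    simp only [div_eq_mul_inv]
    exact ((Function.hasTemperateGrowth_inner_right z.2).sub (.const _)).mul (.const _)
  exact hasTemperateGrowth_cexp_I_mul.comp h

theorem continuous_weylPhase (hbar : ℝ) (z : Phase n) : Continuous (weylPhase hbar z) :=
  (hasTemperateGrowth_weylPhase hbar z).1.continuous

/-- The Heisenberg-Weyl translation by `z` on Schwartz functions. -/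
noncomputable def schwartzWeyl (hbar : ℝ) (z : Phase n) (ψ : 𝓢(Config n, ℂ)) :
    𝓢(Config n, ℂ) :=
  SchwartzMap.smulLeftCLM ℂ (weylPhase hbar z) (ψ.compSubConstCLM ℂ z.1)

theorem schwartzWeyl_apply (hbar : ℝ) (z : Phase n) (ψ : 𝓢(Config n, ℂ)) (x : Config n) :
    schwartzWeyl hbar z ψ x = weylPhase hbar z x * ψ (x - z.1) := by
  rw [schwartzWeyl, SchwartzMap.smulLeftCLM_apply_apply (hasTemperateGrowth_weylPhase hbar z)]
  rfl

theorem memLp_weylPhase_mul (hbar : ℝ) (z : Phase n) (f : L2 n) :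
    MemLp (fun x => weylPhase hbar z x * f (x - z.1)) 2 volume := by
  have h : MemLp (fun x => f (x - z.1)) 2 volume :=
    (Lp.memLp f).comp_measurePreserving (measurePreserving_sub_right volume z.1)
  exact h.of_le ((continuous_weylPhase hbar z).aestronglyMeasurable.mul h.1)
    (.of_forall fun x => by rw [norm_mul, norm_weylPhase, one_mul])

theorem ae_comp_sub {p : Config n → Prop} (h : ∀ᵐ x, p x) (q : Config n) : ∀ᵐ x, p (x - q) :=
  (measurePreserving_sub_right volume q).quasiMeasurePreserving.ae h

/-- The Heisenberg-Weyl translation by `z` on `L²`. -/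
noncomputable def weylShift (hbar : ℝ) (z : Phase n) : L2 n →ₗᵢ[ℂ] L2 n where
  toFun f := (memLp_weylPhase_mul hbar z f).toLp _
  map_add' f g := by
    rw [← MemLp.toLp_add, MemLp.toLp_eq_toLp_iff]
    filter_upwards [ae_comp_sub (Lp.coeFn_add f g) z.1] with x hx
    simp only [hx, Pi.add_apply, mul_add]
  map_smul' c f := by
    rw [RingHom.id_apply, ← MemLp.toLp_const_smul, MemLp.toLp_eq_toLp_iff]
    filter_upwards [ae_comp_sub (Lp.coeFn_smul c f) z.1] with x hx
    simp only [hx, Pi.smul_apply, smul_eq_mul]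
    ring
  norm_map' f := by
    change ‖(memLp_weylPhase_mul hbar z f).toLp _‖ = _
    rw [Lp.norm_toLp, Lp.norm_def]
    congr 1
    rw [← eLpNorm_comp_measurePreserving (Lp.memLp f).1 (measurePreserving_sub_right volume z.1)]
    exact eLpNorm_congr_norm_ae (.of_forall fun x => by
      rw [norm_mul, norm_weylPhase, one_mul]; rfl)

theorem coeFn_weylShift (hbar : ℝ) (z : Phase n) (f : L2 n) :
    weylShift hbar z f =ᵐ[volume] fun x => weylPhase hbar z x * f (x - z.1) :=
  (memLp_weylPhase_mul hbar z f).coeFn_toLp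

theorem weylShift_toLp (hbar : ℝ) (z : Phase n) (ψ : 𝓢(Config n, ℂ)) :
    weylShift hbar z (ψ.toLp 2 volume) = (schwartzWeyl hbar z ψ).toLp 2 volume := by
  apply Lp.ext
  filter_upwards [coeFn_weylShift hbar z (ψ.toLp 2 volume),
    (schwartzWeyl hbar z ψ).coeFn_toLp 2 volume, ae_comp_sub (ψ.coeFn_toLp 2 volume) z.1]
    with x h1 h2 h3
  rw [h1, h2, h3, schwartzWeyl_apply]

theorem eq_of_toLp_eq {F G : L2 n → L2 n} (hF : Continuous F) (hG : Continuous G)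
    (h : ∀ ψ : 𝓢(Config n, ℂ), F (ψ.toLp 2 volume) = G (ψ.toLp 2 volume)) : F = G :=
  (SchwartzMap.denseRange_toLpCLM (E := Config n) (F := ℂ) (p := 2) (μ := volume)
    (by norm_num)).equalizer hF hG (funext h)

/-- The term `-k ⬝ q / 2` in the phase is what makes the cocycle antisymmetric, namely `σ / (2ħ)`.
-/
theorem weylPhase_mul_weylPhase (hbar : ℝ) (z w : Phase n) (x : Config n) :
    weylPhase hbar z x * weylPhase hbar w (x - z.1) =
      Complex.exp (Complex.I * ((sigma z w / (2 * hbar) : ℝ) : ℂ)) * weylPhase hbar (z + w) x := by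
  simp only [weylPhase, ← Complex.exp_add, ← mul_add, ← Complex.ofReal_add, sigma, Prod.fst_add,
    Prod.snd_add, inner_add_left, inner_add_right, inner_sub_right]
  congr 3
  field_simp
  ring

theorem weylShift_weylShift (hbar : ℝ) (z w : Phase n) (f : L2 n) :
    weylShift hbar z (weylShift hbar w f) =
      Complex.exp (Complex.I * ((sigma z w / (2 * hbar) : ℝ) : ℂ)) • weylShift hbar (z + w) f := by
  apply Lp.ext
  filter_upwards [coeFn_weylShift hbar z (weylShift hbar w f),
    ae_comp_sub (coeFn_weylShift hbar w f) z.1, coeFn_weylShift hbar (z + w) f,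
    Lp.coeFn_smul (Complex.exp (Complex.I * ((sigma z w / (2 * hbar) : ℝ) : ℂ)))
      (weylShift hbar (z + w) f)] with x h1 h2 h3 h4
  rw [h1, h2, h4, Pi.smul_apply, h3, ← mul_assoc, weylPhase_mul_weylPhase, smul_eq_mul, mul_assoc,
    Prod.fst_add, sub_sub]

theorem weylShift_zero (hbar : ℝ) (f : L2 n) : weylShift hbar 0 f = f := by
  apply Lp.ext
  filter_upwards [coeFn_weylShift hbar 0 f] with x h
  simp [h, weylPhase]

theorem sigma_self (z : Phase n) : sigma z z = 0 := sub_self _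

theorem sigma_neg_left (z w : Phase n) : sigma (-z) w = -sigma z w := by
  simp [sigma]; ring

theorem sigma_swap (z w : Phase n) : sigma w z = -sigma z w := by
  simp [sigma]

theorem weylShift_neg_weylShift (hbar : ℝ) (z : Phase n) (f : L2 n) :
    weylShift hbar (-z) (weylShift hbar z f) = f := by
  rw [weylShift_weylShift, sigma_neg_left, sigma_self, neg_add_cancel, weylShift_zero]
  simp

theorem weylShift_weylShift_neg (hbar : ℝ) (z : Phase n) (f : L2 n) :
    weylShift hbar z (weylShift hbar (-z) f) = f := by
  simpa using weylShift_neg_weylShift hbar (-z) f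

theorem weylShift_comm (hbar : ℝ) (z w : Phase n) (f : L2 n) :
    weylShift hbar z (weylShift hbar w f) =
      Complex.exp (Complex.I * ((sigma z w / hbar : ℝ) : ℂ)) •
        weylShift hbar w (weylShift hbar z f) := by
  rw [weylShift_weylShift, weylShift_weylShift, smul_smul, ← Complex.exp_add, sigma_swap z w,
    add_comm w z]
  congr 2
  push_cast
  ring

/-- Conjugation of a bounded operator by the Heisenberg-Weyl translation by `z`. -/
noncomputable def shiftConj (hbar : ℝ) (z : Phase n) (A : L2 n →L[ℂ] L2 n) : L2 n →L[ℂ] L2 n :=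
  (weylShift hbar z).toContinuousLinearMap ∘L A ∘L (weylShift hbar (-z)).toContinuousLinearMap

theorem shiftConj_apply (hbar : ℝ) (z : Phase n) (A : L2 n →L[ℂ] L2 n) (f : L2 n) :
    shiftConj hbar z A f = weylShift hbar z (A (weylShift hbar (-z) f)) := rfl

end HeisenbergWeyl

/-! ### Translation covariance of the Weyl correspondence. -/

section Covariance

theorem IsWeyl.unique {hbar : ℝ} {A B : L2 n →L[ℂ] L2 n} {a : 𝓢(Phase n, ℂ)}
    (hA : IsWeyl hbar A a) (hB : IsWeyl hbar B a) : A = B :=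
  DFunLike.coe_injective <| eq_of_toLp_eq A.continuous B.continuous fun ψ =>
    Lp.ext ((hA ψ).trans (hB ψ).symm)

instance : (volume : Measure (Phase n)).IsAddLeftInvariant :=
  inferInstanceAs ((volume : Measure (Config n)).prod volume).IsAddLeftInvariant

theorem weylPhase_mul_weylIntegral {hbar : ℝ} (a : 𝓢(Phase n, ℂ)) (z : Phase n)
    (ψ : 𝓢(Config n, ℂ)) (x : Config n) :
    weylPhase hbar z x * weylIntegral hbar a (schwartzWeyl hbar (-z) ψ) (x - z.1) =
      weylIntegral hbar (a.compSubConstCLM ℂ z) ψ x := by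
  rw [weylIntegral, weylIntegral, mul_left_comm, ← integral_const_mul]
  congr 1
  -- Translating `(y, p)` by `z` moves the shift onto the symbol; the two Weyl phases absorb the
  -- change in the kernel's exponential.
  rw [← integral_sub_right_eq_self _ z]
  congr 1
  ext w
  have ha : ((1 / 2 : ℝ) • (x - z.1 + (w - z).1), (w - z).2) =
      ((1 / 2 : ℝ) • (x + w.1), w.2) - z := by
    ext1
    · simp only [Prod.fst_sub]
      module
    · rfl
  rw [ha, schwartzWeyl_apply, SchwartzMap.compSubConstCLM_apply]
  have hψ : (w - z).1 - (-z).1 = w.1 := by simp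
  have he : weylPhase hbar z x *
      (Complex.exp (Complex.I / (hbar : ℂ) * ((inner ℝ (w - z).2 (x - z.1 - (w - z).1) : ℝ) : ℂ)) *
        weylPhase hbar (-z) (w - z).1) =
      Complex.exp (Complex.I / (hbar : ℂ) * ((inner ℝ w.2 (x - w.1) : ℝ) : ℂ)) := by
    rw [weylPhase, weylPhase, ← Complex.exp_add, ← Complex.exp_add]
    congr 1
    simp only [Prod.fst_sub, Prod.snd_sub, Prod.fst_neg, Prod.snd_neg, inner_sub_left,
      inner_sub_right, inner_neg_left, inner_neg_right]
    push_cast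
    ring
  rw [hψ, ← he]
  ring

theorem IsWeyl.shiftConj {hbar : ℝ} {A : L2 n →L[ℂ] L2 n} {a : 𝓢(Phase n, ℂ)}
    (hA : IsWeyl hbar A a) (z : Phase n) :
    IsWeyl hbar (shiftConj hbar z A) (a.compSubConstCLM ℂ z) := by
  intro ψ
  rw [shiftConj_apply, weylShift_toLp]
  filter_upwards [coeFn_weylShift hbar z (A ((schwartzWeyl hbar (-z) ψ).toLp 2 volume)),
    ae_comp_sub (hA (schwartzWeyl hbar (-z) ψ)) z.1] with x h1 h2
  rw [h1, h2, weylPhase_mul_weylIntegral]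

theorem compInv_compSubConstCLM (a : 𝓢(Phase n, ℂ)) (M : Phase n ≃L[ℝ] Phase n) (z : Phase n) :
    compInv (a.compSubConstCLM ℂ z) M = (compInv a M).compSubConstCLM ℂ (M z) := by
  ext w
  change a (M.symm w - z) = a (M.symm (w - M z))
  rw [map_sub M.symm, M.symm_apply_apply]

/-- Covariance of a Weyl operator under `U` and `M` intertwines the translation by `z` with the
translation by `M z`. -/
theorem conjBy_shiftConj {hbar : ℝ} {M : Phase n ≃L[ℝ] Phase n} {U : L2 n ≃ₗᵢ[ℂ] L2 n}
    (hU : ∀ (a : 𝓢(Phase n, ℂ)) (A : L2 n →L[ℂ] L2 n),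
      IsWeyl hbar A a → IsWeyl hbar (conjBy U A) (compInv a M))
    {A : L2 n →L[ℂ] L2 n} {a : 𝓢(Phase n, ℂ)} (hA : IsWeyl hbar A a) (z : Phase n) :
    conjBy U (shiftConj hbar z A) = shiftConj hbar (M z) (conjBy U A) := by
  have h := hU _ _ (hA.shiftConj z)
  rw [compInv_compSubConstCLM] at h
  exact h.unique ((hU _ _ hA).shiftConj (M z))

end Covariance

/-! ### The Gaussian symbol, the ground state and coherent states. -/

section GroundState

/-- The Gaussian symbol `exp (-(‖x‖² + ‖p‖²) / ħ)`. -/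
noncomputable def gaussianSymbol (n : ℕ) (hbar : ℝ) (hpos : 0 < hbar) : 𝓢(Phase n, ℂ) :=
  SchwartzMap.compCLMOfContinuousLinearEquiv ℂ
    (WithLp.prodContinuousLinearEquiv 2 ℝ (Config n) (Config n)).symm
    (normGaussian hbar⁻¹ (inv_pos.2 hpos))

theorem gaussianSymbol_apply {hbar : ℝ} (hpos : 0 < hbar) (z : Phase n) :
    gaussianSymbol n hbar hpos z =
      Complex.exp (-(hbar⁻¹ : ℂ) * ((‖z.1‖ : ℂ) ^ 2 + (‖z.2‖ : ℂ) ^ 2)) := by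
  change normGaussian hbar⁻¹ (inv_pos.2 hpos) (WithLp.toLp 2 z) = _
  rw [normGaussian_apply, ← Complex.ofReal_pow, WithLp.prod_norm_sq_eq_of_L2]
  push_cast
  rfl

/-- The unnormalized ground state `exp (-‖x‖² / (2ħ))`. -/
noncomputable def groundState (n : ℕ) (hbar : ℝ) (hpos : 0 < hbar) : 𝓢(Config n, ℂ) :=
  normGaussian (2 * hbar)⁻¹ (by positivity)

theorem groundState_apply {hbar : ℝ} (hpos : 0 < hbar) (x : Config n) :
    groundState n hbar hpos x = Complex.exp (-((2 * hbar)⁻¹ : ℂ) * (‖x‖ : ℂ) ^ 2) := by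
  rw [groundState, normGaussian_apply]
  push_cast
  rfl

theorem conj_groundState {hbar : ℝ} (hpos : 0 < hbar) (x : Config n) :
    starRingEnd ℂ (groundState n hbar hpos x) = groundState n hbar hpos x := by
  rw [groundState_apply, ← Complex.exp_conj]
  simp [Complex.conj_ofNat]

/-- The weight of the ground state projection in the Weyl operator of `gaussianSymbol`. -/
noncomputable def gaussianWeight (n : ℕ) (hbar : ℝ) : ℂ :=
  (((1 / (2 * Real.pi * hbar)) ^ n : ℝ) : ℂ) * (Real.pi / (hbar⁻¹ : ℂ)) ^ (n / 2 : ℂ)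

theorem gaussianWeight_ne_zero {hbar : ℝ} (hpos : 0 < hbar) : gaussianWeight n hbar ≠ 0 := by
  refine mul_ne_zero (Complex.ofReal_ne_zero.2 (by positivity)) ?_
  rw [Complex.cpow_ne_zero_iff]
  left
  have := hpos.ne'
  have := Real.pi_ne_zero
  simp [*]

theorem inv_re_pos {hbar : ℝ} (hpos : 0 < hbar) : 0 < ((hbar : ℂ)⁻¹).re := by
  rw [← Complex.ofReal_inv, Complex.ofReal_re]
  positivity

/-- The kernel factors because `‖x + y‖²/4 + ‖x - y‖²/4 = (‖x‖² + ‖y‖²)/2`: the first term comes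
from the symbol, the second from its Fourier transform in `p`. -/
theorem gaussianSymbol_fourier {hbar : ℝ} (hpos : 0 < hbar) (x y : Config n) :
    ∫ p : Config n, Complex.exp (Complex.I / (hbar : ℂ) * ((inner ℝ p (x - y) : ℝ) : ℂ)) *
        gaussianSymbol n hbar hpos ((1 / 2 : ℝ) • (x + y), p) =
      (Real.pi / (hbar⁻¹ : ℂ)) ^ (n / 2 : ℂ) *
        (groundState n hbar hpos x * groundState n hbar hpos y) := by
  have h := GaussianFourier.integral_cexp_neg_mul_sq_norm_add (V := Config n) (inv_re_pos hpos)
    (Complex.I / (hbar : ℂ)) (x - y)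
  rw [finrank_euclideanSpace_fin] at h
  have hpt : ∀ p : Config n,
      Complex.exp (Complex.I / (hbar : ℂ) * ((inner ℝ p (x - y) : ℝ) : ℂ)) *
        gaussianSymbol n hbar hpos ((1 / 2 : ℝ) • (x + y), p) =
      Complex.exp (-(hbar⁻¹ : ℂ) * (‖(1 / 2 : ℝ) • (x + y)‖ : ℂ) ^ 2) *
        Complex.exp (-(hbar : ℂ)⁻¹ * (‖p‖ : ℂ) ^ 2 +
          Complex.I / (hbar : ℂ) * ((inner ℝ (x - y) p : ℝ) : ℂ)) := by
    intro p
    rw [gaussianSymbol_apply, ← Complex.exp_add, ← Complex.exp_add, real_inner_comm]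
    congr 1
    ring
  simp_rw [hpt]
  rw [integral_const_mul, h, mul_left_comm, ← Complex.exp_add, groundState_apply,
    groundState_apply, ← Complex.exp_add]
  congr 2
  have h1 : ‖(1 / 2 : ℝ) • (x + y)‖ ^ 2 = (‖x‖ ^ 2 + 2 * inner ℝ x y + ‖y‖ ^ 2) / 4 := by
    rw [norm_smul, mul_pow, norm_add_sq_real]
    norm_num
    ring
  have h2 := norm_sub_sq_real x y
  have hh : (hbar : ℂ) ≠ 0 := Complex.ofReal_ne_zero.2 hpos.ne'
  rw [← Complex.ofReal_pow, ← Complex.ofReal_pow, h1, h2, div_pow, Complex.I_sq]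
  push_cast
  field_simp
  ring

/-- Needed for Fubini; the integrand is dominated by `|ψ(y)| exp(-‖p‖²/ħ)`. -/
theorem integrable_weylIntegrand_gaussianSymbol {hbar : ℝ} (hpos : 0 < hbar)
    (ψ : 𝓢(Config n, ℂ)) (x : Config n) :
    Integrable (fun w : Phase n =>
      Complex.exp (Complex.I / (hbar : ℂ) * ((inner ℝ w.2 (x - w.1) : ℝ) : ℂ)) *
        gaussianSymbol n hbar hpos ((1 / 2 : ℝ) • (x + w.1), w.2) * ψ w.1)
      ((volume : Measure (Config n)).prod volume) := by
  have hG : Integrable (normGaussian (H := Config n) hbar⁻¹ (inv_pos.2 hpos)) volume :=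
    SchwartzMap.integrable _
  refine (ψ.integrable.mul_prod hG).mono ?_ (.of_forall fun w => ?_)
  · refine Continuous.aestronglyMeasurable ?_
    have := (gaussianSymbol n hbar hpos).continuous
    have := ψ.continuous
    fun_prop
  · have h1 : ‖Complex.exp (Complex.I / (hbar : ℂ) * ((inner ℝ w.2 (x - w.1) : ℝ) : ℂ))‖ = 1 := by
      rw [div_mul_eq_mul_div, mul_div_assoc, ← Complex.ofReal_div, mul_comm,
        Complex.norm_exp_ofReal_mul_I]
    have h2 : ‖gaussianSymbol n hbar hpos ((1 / 2 : ℝ) • (x + w.1), w.2)‖ ≤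
        ‖normGaussian hbar⁻¹ (inv_pos.2 hpos) w.2‖ := by
      rw [gaussianSymbol_apply, normGaussian_apply, Complex.norm_exp, Complex.norm_exp,
        Real.exp_le_exp]
      simp only [← Complex.ofReal_pow, ← Complex.ofReal_add, ← Complex.ofReal_inv,
        ← Complex.ofReal_neg, ← Complex.ofReal_mul, Complex.ofReal_re]
      have := inv_pos.2 hpos
      nlinarith [mul_nonneg this.le (sq_nonneg ‖(1 / 2 : ℝ) • (x + w.1)‖)]
    rw [norm_mul, norm_mul, h1, one_mul, norm_mul, mul_comm]
    exact mul_le_mul_of_nonneg_left h2 (norm_nonneg _)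

theorem weylIntegral_gaussianSymbol {hbar : ℝ} (hpos : 0 < hbar) (ψ : 𝓢(Config n, ℂ))
    (x : Config n) :
    weylIntegral hbar (gaussianSymbol n hbar hpos) ψ x =
      gaussianWeight n hbar *
        ((∫ y, groundState n hbar hpos y * ψ y) * groundState n hbar hpos x) := by
  rw [weylIntegral, gaussianWeight, mul_assoc (((1 / (2 * Real.pi * hbar)) ^ n : ℝ) : ℂ)]
  congr 1
  rw [Measure.volume_eq_prod, integral_prod _ (integrable_weylIntegrand_gaussianSymbol hpos ψ x)]
  simp_rw [integral_mul_const, gaussianSymbol_fourier]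
  rw [← integral_mul_const, ← integral_const_mul]
  congr 1
  ext y
  ring

theorem isWeyl_gaussianSymbol {hbar : ℝ} (hpos : 0 < hbar) :
    IsWeyl hbar (gaussianWeight n hbar • InnerProductSpace.rankOne ℂ
      ((groundState n hbar hpos).toLp 2 volume) ((groundState n hbar hpos).toLp 2 volume))
      (gaussianSymbol n hbar hpos) := by
  intro ψ
  have h : inner ℂ ((groundState n hbar hpos).toLp 2 volume) (ψ.toLp 2 volume) =
      ∫ y, groundState n hbar hpos y * ψ y := by
    rw [SchwartzMap.inner_toL2_toL2_eq _ _ volume]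
    congr 1
    ext y
    rw [RCLike.inner_apply, conj_groundState, mul_comm]
  rw [_root_.smul_apply, InnerProductSpace.rankOne_apply, h, smul_smul]
  filter_upwards [Lp.coeFn_smul (gaussianWeight n hbar * ∫ y, groundState n hbar hpos y * ψ y)
    ((groundState n hbar hpos).toLp 2 volume), (groundState n hbar hpos).coeFn_toLp 2 volume]
    with x h1 h2
  rw [h1, Pi.smul_apply, h2, weylIntegral_gaussianSymbol, smul_eq_mul, mul_assoc]

theorem inner_groundState_weylShift_ne_zero {hbar : ℝ} (hpos : 0 < hbar) (z : Phase n) :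
    inner ℂ ((groundState n hbar hpos).toLp 2 volume)
      (weylShift hbar z ((groundState n hbar hpos).toLp 2 volume)) ≠ 0 := by
  have hh : (hbar : ℂ) ≠ 0 := Complex.ofReal_ne_zero.2 hpos.ne'
  rw [weylShift_toLp, SchwartzMap.inner_toL2_toL2_eq _ _ volume,
    -- Centring at the midpoint `q/2` cancels the cross terms and the constant phase, leaving the
    -- Fourier transform of a Gaussian, which never vanishes.
    ← integral_add_right_eq_self _ ((1 / 2 : ℝ) • z.1)]
  have hpt : ∀ x : Config n, inner ℂ (groundState n hbar hpos (x + (1 / 2 : ℝ) • z.1))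
      (schwartzWeyl hbar z (groundState n hbar hpos) (x + (1 / 2 : ℝ) • z.1)) =
      Complex.exp (-(4 * hbar : ℂ)⁻¹ * (‖z.1‖ : ℂ) ^ 2) *
        Complex.exp (-(hbar : ℂ)⁻¹ * (‖x‖ : ℂ) ^ 2 +
          Complex.I / (hbar : ℂ) * ((inner ℝ z.2 x : ℝ) : ℂ)) := by
    intro x
    have hx : x + (1 / 2 : ℝ) • z.1 - z.1 = x - (1 / 2 : ℝ) • z.1 := by module
    rw [RCLike.inner_apply, conj_groundState, schwartzWeyl_apply, hx, groundState_apply,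
      groundState_apply, weylPhase, ← Complex.exp_add, ← Complex.exp_add, ← Complex.exp_add]
    congr 1
    have h1 := norm_add_sq_real x ((1 / 2 : ℝ) • z.1)
    have h2 := norm_sub_sq_real x ((1 / 2 : ℝ) • z.1)
    have h3 : ‖(1 / 2 : ℝ) • z.1‖ ^ 2 = ‖z.1‖ ^ 2 / 4 := by
      rw [norm_smul, mul_pow]
      norm_num
      ring
    rw [← Complex.ofReal_pow, ← Complex.ofReal_pow, h1, h2, h3, inner_add_right,
      real_inner_smul_right, real_inner_smul_right]
    push_cast
    field_simp
    ring
  simp_rw [hpt]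
  rw [integral_const_mul, GaussianFourier.integral_cexp_neg_mul_sq_norm_add (inv_re_pos hpos)]
  refine mul_ne_zero (Complex.exp_ne_zero _) (mul_ne_zero ?_ (Complex.exp_ne_zero _))
  rw [Complex.cpow_ne_zero_iff]
  left
  have := hpos.ne'
  have := Real.pi_ne_zero
  simp [*]

end GroundState

/-! ### Rigidity: from common eigenvectors to the symplectic form. -/

section Rigidity

/-- Eigenvectors of an isometry that are not orthogonal to a given eigenvector have the same
eigenvalue. -/
theorem exists_smul_of_mem_span {H : Type*} [NormedAddCommGroup H]
    [InnerProductSpace ℂ H] (V : H →ₗᵢ[ℂ] H) {g : H} (hg : g ≠ 0)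
    (hV : V g ∈ Submodule.span ℂ {g}) :
    ∃ c : ℂ, c ≠ 0 ∧
      ∀ f : H, inner ℂ g f ≠ 0 → V f ∈ Submodule.span ℂ {f} → V f = c • f := by
  obtain ⟨c, hc⟩ := Submodule.mem_span_singleton.1 hV
  -- Preservation of `⟨g, f⟩ ≠ 0` forces `c̄ d = 1`; the case `f = g` gives `c̄ c = 1`, whence `d =
  -- c`.
  have key : ∀ (f : H) (d : ℂ), inner ℂ g f ≠ 0 → d • f = V f → starRingEnd ℂ c * d = 1 := by
    intro f d hf hd
    have h := V.inner_map_map g f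
    rw [← hc, ← hd, inner_smul_left, inner_smul_right, ← mul_assoc] at h
    exact mul_right_cancel₀ hf (h.trans (one_mul _).symm)
  have hcc := key g c (inner_self_ne_zero.2 hg) hc
  refine ⟨c, right_ne_zero_of_mul_eq_one hcc, fun f hf hVf => ?_⟩
  obtain ⟨d, hd⟩ := Submodule.mem_span_singleton.1 hVf
  rw [← hd, mul_left_cancel₀ (left_ne_zero_of_mul_eq_one hcc) ((key f d hf hd).trans hcc.symm)]

theorem eq_of_exp_I_mul_eq {s t : ℝ}
    (h : ∀ r : ℝ, Complex.exp (Complex.I * ((r * s : ℝ) : ℂ)) =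
      Complex.exp (Complex.I * ((r * t : ℝ) : ℂ))) : s = t := by
  by_contra hst
  have hd : s - t ≠ 0 := sub_ne_zero.2 hst
  -- For this `r` the two phases differ by `π`, so the exponentials are opposite.
  have h1 := h (Real.pi / (s - t))
  have h2 : Complex.exp (Complex.I * ((Real.pi / (s - t) * s : ℝ) : ℂ)) =
      Complex.exp (Complex.I * ((Real.pi / (s - t) * t : ℝ) : ℂ)) *
        Complex.exp (Real.pi * Complex.I) := by
    rw [← Complex.exp_add]
    congr 1
    have : Real.pi / (s - t) * s = Real.pi / (s - t) * t + Real.pi := by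
      field_simp
      ring
    rw [this]
    push_cast
    ring
  rw [h1, Complex.exp_pi_mul_I] at h2
  have h3 := Complex.exp_ne_zero (Complex.I * ((Real.pi / (s - t) * t : ℝ) : ℂ))
  exact h3 (by linear_combination h2 / 2)

/-- `U⁻¹ W(M z)⁻¹ U W(z)` for the translations `W`. -/
noncomputable def shiftDefect (hbar : ℝ) (U : L2 n ≃ₗᵢ[ℂ] L2 n) (M : Phase n ≃L[ℝ] Phase n)
    (z : Phase n) : L2 n →ₗᵢ[ℂ] L2 n :=
  U.symm.toLinearIsometry.comp ((weylShift hbar (-(M z))).comp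
    (U.toLinearIsometry.comp (weylShift hbar z)))

theorem shiftDefect_apply (hbar : ℝ) (U : L2 n ≃ₗᵢ[ℂ] L2 n) (M : Phase n ≃L[ℝ] Phase n)
    (z : Phase n) (f : L2 n) :
    shiftDefect hbar U M z f = U.symm (weylShift hbar (-(M z)) (U (weylShift hbar z f))) := rfl

theorem map_weylShift_of_shiftDefect {hbar : ℝ} {U : L2 n ≃ₗᵢ[ℂ] L2 n}
    {M : Phase n ≃L[ℝ] Phase n} {z : Phase n} {f : L2 n} {c : ℂ}
    (h : shiftDefect hbar U M z f = c • f) :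
    U (weylShift hbar z f) = c • weylShift hbar (M z) (U f) := by
  rw [shiftDefect_apply, LinearIsometryEquiv.symm_apply_eq] at h
  rw [← weylShift_weylShift_neg hbar (M z) (U (weylShift hbar z f)), h, map_smul, map_smul]

theorem shiftDefect_commute {hbar : ℝ} {M : Phase n ≃L[ℝ] Phase n} {U : L2 n ≃ₗᵢ[ℂ] L2 n}
    (hU : ∀ (a : 𝓢(Phase n, ℂ)) (A : L2 n →L[ℂ] L2 n),
      IsWeyl hbar A a → IsWeyl hbar (conjBy U A) (compInv a M))
    {A : L2 n →L[ℂ] L2 n} {a : 𝓢(Phase n, ℂ)} (hA : IsWeyl hbar A a) (z : Phase n) (f : L2 n) :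
    shiftDefect hbar U M z (A f) = A (shiftDefect hbar U M z f) := by
  have h := DFunLike.congr_fun (conjBy_shiftConj hU hA z) (U (weylShift hbar z f))
  change U (weylShift hbar z (A (weylShift hbar (-z) (U.symm (U (weylShift hbar z f)))))) =
    weylShift hbar (M z) (U (A (U.symm (weylShift hbar (-(M z)) (U (weylShift hbar z f)))))) at h
  rw [U.symm_apply_apply, weylShift_neg_weylShift] at h
  rw [shiftDefect_apply, shiftDefect_apply, h, weylShift_neg_weylShift, U.symm_apply_apply]

/-- An operator commuting with a rank-one operator preserves its range; here the range is spanned by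
the coherent state, on which the rank-one operator acts by a nonzero scalar. -/
theorem shiftDefect_coherentState_mem_span {hbar : ℝ} (hpos : 0 < hbar)
    {M : Phase n ≃L[ℝ] Phase n} {U : L2 n ≃ₗᵢ[ℂ] L2 n}
    (hU : ∀ (a : 𝓢(Phase n, ℂ)) (A : L2 n →L[ℂ] L2 n),
      IsWeyl hbar A a → IsWeyl hbar (conjBy U A) (compInv a M))
    (hg : (groundState n hbar hpos).toLp 2 volume ≠ 0) (z w : Phase n) :
    shiftDefect hbar U M z (weylShift hbar w ((groundState n hbar hpos).toLp 2 volume)) ∈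
      Submodule.span ℂ {weylShift hbar w ((groundState n hbar hpos).toLp 2 volume)} := by
  have h := shiftDefect_commute hU ((isWeyl_gaussianSymbol hpos).shiftConj w) z
    (weylShift hbar w ((groundState n hbar hpos).toLp 2 volume))
  simp only [shiftConj_apply, weylShift_neg_weylShift, _root_.smul_apply,
    InnerProductSpace.rankOne_apply, map_smul, smul_smul] at h
  have hne := mul_ne_zero (gaussianWeight_ne_zero (n := n) hpos)
    ((inner_self_ne_zero (𝕜 := ℂ)).2 hg)
  rw [← inv_smul_smul₀ hne (shiftDefect hbar U M z _), h, smul_smul]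
  exact Submodule.smul_mem _ _ (Submodule.mem_span_singleton_self _)

theorem isSymplectic_of_weyl_covariant {hbar : ℝ} (hpos : 0 < hbar)
    {M : Phase n ≃L[ℝ] Phase n} {U : L2 n ≃ₗᵢ[ℂ] L2 n}
    (hU : ∀ (a : 𝓢(Phase n, ℂ)) (A : L2 n →L[ℂ] L2 n),
      IsWeyl hbar A a → IsWeyl hbar (conjBy U A) (compInv a M)) :
    IsSymplectic M := by
  set g : L2 n := (groundState n hbar hpos).toLp 2 volume with hgdef
  have hg : g ≠ 0 := by
    intro h0
    refine inner_groundState_weylShift_ne_zero hpos (0 : Phase n) ?_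
    rw [← hgdef, h0, inner_zero_left]
  have hshift : ∀ z : Phase n, ∃ c : ℂ, c ≠ 0 ∧ ∀ w : Phase n,
      U (weylShift hbar z (weylShift hbar w g)) =
        c • weylShift hbar (M z) (U (weylShift hbar w g)) := by
    intro z
    obtain ⟨c, hc, hcf⟩ := exists_smul_of_mem_span (shiftDefect hbar U M z) hg (by
      simpa [weylShift_zero] using shiftDefect_coherentState_mem_span hpos hU hg z 0)
    exact ⟨c, hc, fun w => map_weylShift_of_shiftDefect
      (hcf _ (inner_groundState_weylShift_ne_zero hpos w)
        (shiftDefect_coherentState_mem_span hpos hU hg z w))⟩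
  choose c hc0 hc using hshift
  have hc' : ∀ z, U (weylShift hbar z g) = c z • weylShift hbar (M z) (U g) := fun z => by
    simpa [weylShift_zero] using hc z 0
  have hexp : ∀ z w : Phase n,
      Complex.exp (Complex.I * ((sigma (M z) (M w) / hbar : ℝ) : ℂ)) =
        Complex.exp (Complex.I * ((sigma z w / hbar : ℝ) : ℂ)) := by
    intro z w
    have h1 := hc z w
    -- `U W(z) W(w) g` is expanded in both orders; each yields `c z * c w` times the same nonzero
    -- vector, up to the two commutation phases.
    rw [weylShift_comm hbar z w, map_smul, hc, hc', hc', map_smul, map_smul, weylShift_comm hbar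
      (M z) (M w), smul_smul, smul_smul, smul_smul, smul_smul] at h1
    have hne : weylShift hbar (M w) (weylShift hbar (M z) (U g)) ≠ 0 := by
      simpa only [ne_eq, map_eq_zero_iff _ (LinearIsometry.injective _),
        map_eq_zero_iff _ U.injective] using hg
    have h2 := smul_left_injective ℂ hne h1
    refine mul_left_cancel₀ (mul_ne_zero (hc0 z) (hc0 w)) ?_
    linear_combination -h2
  intro z w
  have h : sigma (M z) (M w) / hbar = sigma z w / hbar := by
    refine eq_of_exp_I_mul_eq fun r => ?_
    have hr := hexp (r • z) w
    have hs : ∀ u v : Phase n, sigma (r • u) v = r * sigma u v := fun u v => by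
      simp only [sigma, Prod.smul_fst, Prod.smul_snd, real_inner_smul_left, real_inner_smul_right]
      ring
    rwa [map_smul, hs, hs, mul_div_assoc, mul_div_assoc] at hr
  exact (div_left_inj' hpos.ne').1 h

end Rigidity

end WeylCovariance

theorem corollary1 (n : ℕ) (hbar : ℝ) (hpos : 0 < hbar)
    (M : WeylCovariance.Phase n ≃L[ℝ] WeylCovariance.Phase n)
    (hM : ∃ U : WeylCovariance.L2 n ≃ₗᵢ[ℂ] WeylCovariance.L2 n,
      ∀ (a : 𝓢(WeylCovariance.Phase n, ℂ))
        (A : WeylCovariance.L2 n →L[ℂ] WeylCovariance.L2 n),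
        WeylCovariance.IsWeyl hbar A a →
          WeylCovariance.IsWeyl hbar (WeylCovariance.conjBy U A) (WeylCovariance.compInv a M)) :
    WeylCovariance.IsSymplectic M ∨ WeylCovariance.IsAntisymplectic M := by
  obtain ⟨U, hU⟩ := hM
  -- A complex-linear `U` always yields the symplectic alternative.
  exact Or.inl (WeylCovariance.isSymplectic_of_weyl_covariant hpos hU)
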